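/- Let $N$ be a lattice of rank $n$ and let $\Sigma$ be a fan in $N_{\mathbb R}=N\otimes_{\mathbb Z}\mathbb R\cong\mathbb R^n$, i.e. a finite nonempty collection of strongly convex rational polyhedral cones that contains every face of each of its cones and in which any two cones intersect in a common face. Write $\Sigma(1)$ for the set of one-dimensional cones of $\Sigma$ and $|\Sigma|$ for the union of its cones, and assume that $|\Sigma|$ is convex of dimension $n$. A subset $P\subseteq\Sigma(1)$ is called a primitive collection for $\Sigma$ if $P$ is not contained in a single cone of $\Sigma$ (that is, no cone of $\Sigma$ contains all the rays in $P$), but every proper subset of $P$ is. A fan with convex $n$-dimensional support is called quasi-projective if there is a function $\phi:|\Sigma|\to\mathbb R$, linear on each cone of $\Sigma$, such that $\phi(u)+\phi(v)>\phi(u+v)$ for all $u,v\in|\Sigma|$ not lying in the same cone of $\Sigma$ (equivalently, the toric variety $X_\Sigma$ is quasi-projective). Let $P$ be a primitive collection for $\Sigma$. Then there exists a simplicial refinement $\Sigma'$ of $\Sigma$ (a fan with $|\Sigma'|=|\Sigma|$, each of whose cones is generated by linearly independent vectors and is contained in a cone of $\Sigma$) with $\Sigma'(1)=\Sigma(1)$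 such that $P$ is a primitive collection for $\Sigma'$. Furthermore, if $\Sigma$ is quasi-projective, then $\Sigma'$ can be chosen to be quasi-projective. -/

import Mathlib

open scoped TensorProduct

/-- The real vector space `N_ℝ = N ⊗_ℤ ℝ` spanned by a lattice `N`. -/
abbrev RealSpan (N : Type*) [AddCommGroup N] : Type _ := ℝ ⊗[ℤ] N

/-- A rational polyhedral cone in `N_ℝ`: the set of nonnegative real combinations of finitely many
lattice vectors. -/
def IsRationalPolyhedral {N : Type*} [AddCommGroup N] (σ : PointedCone ℝ (RealSpan N)) : Prop :=
  ∃ s : Finset N, σ = PointedCone.hull ℝ ((fun v : N => (1 : ℝ) ⊗ₜ[ℤ] v) '' (s : Set N))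

/-- A fan in `N_ℝ`: a finite nonempty collection of strongly convex rational polyhedral cones,
containing all faces of its members, in which any two cones intersect in a common face.
(The cones being polyhedral, the faces in the sense of `PointedCone.IsFaceOf` are the intersections
of the cone with its supporting hyperplanes, and the cone itself.) -/
structure ToricFan (N : Type*) [AddCommGroup N] where
  cones : Set (PointedCone ℝ (RealSpan N))
  finite : cones.Finite
  nonempty : cones.Nonempty
  rational : ∀ σ ∈ cones, IsRationalPolyhedral σ
  stronglyConvex : ∀ σ ∈ cones, σ.toConvexCone.Salient
  face_mem : ∀ σ ∈ cones, ∀ τ : PointedCone ℝ (RealSpan N), τ.IsFaceOf σ → τ ∈ cones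
  inter_face : ∀ σ ∈ cones, ∀ τ ∈ cones, (σ ⊓ τ).IsFaceOf σ ∧ (σ ⊓ τ).IsFaceOf τ

namespace ToricFan

variable {N : Type*} [AddCommGroup N]

/-- The support `|Σ|`: the union of the cones of the fan. -/
def support (F : ToricFan N) : Set (RealSpan N) := {u | ∃ σ ∈ F.cones, u ∈ σ}

/-- `Σ(1)`: the one-dimensional cones of the fan. -/
def rays (F : ToricFan N) : Set (PointedCone ℝ (RealSpan N)) :=
  {ρ | ρ ∈ F.cones ∧
    Module.finrank ℝ (Submodule.span ℝ (ρ : Set (RealSpan N))) = 1}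

/-- The support of the fan is convex of dimension `n = rank N = dim N_ℝ`. (It contains the origin,
so its dimension is that of its linear span.) -/
def HasConvexFullSupport (F : ToricFan N) : Prop :=
  Convex ℝ F.support ∧
    Module.finrank ℝ (Submodule.span ℝ F.support) = Module.finrank ℤ N

/-- A fan is simplicial if each of its cones is generated by linearly independent vectors. -/
def Simplicial (F : ToricFan N) : Prop := ∀ σ ∈ F.cones, PointedCone.IsSimplicial σ

/-- `F'.Refines F`: the two fans have the same support, and each cone of `F'` is contained in a
cone of `F`. -/
def Refines (F' F : ToricFan N) : Prop :=
  F'.support = F.support ∧ ∀ σ' ∈ F'.cones, ∃ σ ∈ F.cones, σ' ≤ σ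

/-- All the rays in `Q` are contained in one single cone of the fan. -/
def InSingleCone (F : ToricFan N) (Q : Set (PointedCone ℝ (RealSpan N))) : Prop :=
  ∃ σ ∈ F.cones, ∀ ρ ∈ Q, ρ ≤ σ

/-- `P ⊆ Σ(1)` is a primitive collection if `P` is not contained in a single cone of the fan but
every proper subset of `P` is. -/
def IsPrimitiveCollection (F : ToricFan N) (P : Set (PointedCone ℝ (RealSpan N))) : Prop :=
  P ⊆ F.rays ∧ ¬ F.InSingleCone P ∧ ∀ Q, Q ⊂ P → F.InSingleCone Q

/-- `φ` is a piecewise-linear function on the fan: on each cone it agrees with a linear form on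
`N_ℝ`. (Only the values of `φ` on the support matter.) -/
def IsPiecewiseLinear (F : ToricFan N) (φ : RealSpan N → ℝ) : Prop :=
  ∀ σ ∈ F.cones, ∃ m : Module.Dual ℝ (RealSpan N), ∀ u ∈ σ, φ u = m u

/-- `φ` is strictly convex on the fan, with the sign convention `φ u + φ v > φ (u + v)` for
all `u, v` in the support that do not lie in the same cone. -/
def IsStrictlyConvex (F : ToricFan N) (φ : RealSpan N → ℝ) : Prop :=
  ∀ u ∈ F.support, ∀ v ∈ F.support, (¬ ∃ σ ∈ F.cones, u ∈ σ ∧ v ∈ σ) → φ (u + v) < φ u + φ v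

/-- A fan (with convex support of full dimension) is quasi-projective if it carries a strictly
convex piecewise-linear function. -/
def QuasiProjective (F : ToricFan N) : Prop :=
  ∃ φ : RealSpan N → ℝ, F.IsPiecewiseLinear φ ∧ F.IsStrictlyConvex φ

end ToricFan

/-! Fix a lattice generator `u ρ` of each ray and a weight `w` on coefficient vectors. Every point
of the support is a nonnegative combination of rays of one cone; call such a combination admissible,
and keep those of least weight for their value. If `w` is positive and generic, each point has
exactly one minimal combination (`exists_isMinRep`, `IsMinRep.unique`), and shrinking its support
preserves minimality. Hence the cones on the supports of minimal combinations form a simplicial fan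
refining the given one (`exists_toricFan_cones_eq`). Its rays are unchanged, since `u ρ` has only
the obvious admissible representation.

To keep `P` primitive, `w` is made very large off `P` (`exists_isGenericWeight`). Then every
combination of rays in `P` minus one ray is minimal (`isMinRep_of_ssubset_primitive`), so proper
subsets of `P` still span into cones. No new cone contains all of `P`, because each lies in an old
one.

If `φ` is strictly convex on the old fan, extend its values on the generators to a linear `Φ` on
coefficients. For small `ε`, minimizing `Φ + ε • w` over all nonnegative combinations selects
exactly the `w`-minimal admissible ones (`exists_pos_isMinRep_iff`). The minimum value, as a
function of the point, is strictly convex on the new fan. -/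

/-! ### Minimal nonnegative representations: existence, uniqueness, independence. -/

section MinimalRepresentations

open Function Filter

variable {ι V : Type*} [Fintype ι] [AddCommGroup V] [Module ℝ V]

theorem exists_pos_nonneg_add_smul {h r : ι → ℝ} (hh : 0 ≤ h) (hr : support r ⊆ support h) :
    ∃ t : ℝ, 0 < t ∧ 0 ≤ h + t • r := by
  have key : ∀ i, ∀ᶠ K : ℝ in atTop, 0 ≤ K * h i + r i := by
    intro i
    by_cases hi : h i = 0
    · have : r i = 0 := by
        by_contra hne
        exact hr (mem_support.2 hne) hi
      simp [hi, this]
    · have hpos : 0 < h i := lt_of_le_of_ne (hh i) (Ne.symm hi)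
      filter_upwards [eventually_ge_atTop (-r i / h i)] with K hK
      rw [div_le_iff₀ hpos] at hK
      linarith
  obtain ⟨K, hK, hK0⟩ := ((eventually_all.2 key).and (eventually_gt_atTop (0 : ℝ))).exists
  refine ⟨K⁻¹, inv_pos.2 hK0, fun i => ?_⟩
  have h1 := mul_nonneg (inv_pos.2 hK0).le (hK i)
  have : K⁻¹ * (K * h i + r i) = h i + K⁻¹ * r i := by field_simp
  simpa [this] using h1

/-- `c` is a nonnegative representation of `L c` with admissible support whose weight `w c` is
minimal among all such representations of `L c`. -/
def IsMinRep (L : (ι → ℝ) →ₗ[ℝ] V) (A : Set ι → Prop) (w : (ι → ℝ) →ₗ[ℝ] ℝ) (c : ι → ℝ) : Prop :=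
  0 ≤ c ∧ A (support c) ∧ ∀ d, 0 ≤ d → A (support d) → L d = L c → w c ≤ w d

/-- The supports of two admissible representations of the same vector are compatible. -/
structure IsCompatible (L : (ι → ℝ) →ₗ[ℝ] V) (A : Set ι → Prop) : Prop where
  mono : ∀ ⦃S T⦄, A S → T ⊆ S → A T
  union : ∀ ⦃c d S⦄, 0 ≤ c → 0 ≤ d → L c = L d → support c ⊆ S → A S → A (support d) →
    A (S ∪ support d)

/-- The weight `w` does not vanish on all linear relations supported in a dependent set. -/
def IsGenericWeight (L : (ι → ℝ) →ₗ[ℝ] V) (w : (ι → ℝ) →ₗ[ℝ] ℝ) : Prop :=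
  ∀ T : Set ι, (∃ r, r ≠ 0 ∧ support r ⊆ T ∧ L r = 0) → ∃ r, support r ⊆ T ∧ L r = 0 ∧ w r ≠ 0

variable {L : (ι → ℝ) →ₗ[ℝ] V} {A : Set ι → Prop} {w : (ι → ℝ) →ₗ[ℝ] ℝ} {c d : ι → ℝ}

/-- Exchange argument: if `e` represents `L d`, then `c - t • d + t • e` represents `L c` and is
nonnegative for small `t > 0`. Compatibility makes it admissible, so minimality of `c` gives `w d ≤
w e`. -/
theorem IsMinRep.of_support_subset (hA : IsCompatible L A) (hc : IsMinRep L A w c) (hd : 0 ≤ d)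
    (hdc : support d ⊆ support c) : IsMinRep L A w d := by
  refine ⟨hd, hA.mono hc.2.1 hdc, fun e he hAe hL => ?_⟩
  obtain ⟨t, ht, hnn⟩ := exists_pos_nonneg_add_smul (h := c) (r := -d) hc.1 (by simpa using hdc)
  have hU := hA.union hd he hL.symm hdc hc.2.1 hAe
  have h1 := hc.2.2 (c + t • (-d) + t • e) (add_nonneg hnn (smul_nonneg ht.le he))
    (hA.mono hU ?_) (by simp [hL])
  · simp only [map_add, map_smul, map_neg, smul_eq_mul] at h1
    nlinarith
  · intro i hi
    by_contra hcon
    simp only [Set.mem_union, mem_support, not_or, not_not] at hcon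
    have : d i = 0 := by
      by_contra hne
      exact hdc (mem_support.2 hne) hcon.1
    exact hi (by simp [hcon, this])

/-- Two distinct minimal representations give a relation on the union of their supports, so
genericity gives one, `r`, with `w r ≠ 0`. The midpoint of `c` and `d` is positive on that whole
union, so it can be moved a little along both `r` and `-r`; one of the moves lowers the weight. -/
theorem IsMinRep.unique (hA : IsCompatible L A) (hw : IsGenericWeight L w)
    (hc : IsMinRep L A w c) (hd : IsMinRep L A w d) (hL : L c = L d) : c = d := by
  by_contra hne
  have hU := hA.union hc.1 hd.1 hL subset_rfl hc.2.1 hd.2.1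
  have hsub : support (c - d) ⊆ support c ∪ support d := support_sub c d
  obtain ⟨r, hr, hLr, hwr⟩ := hw _ ⟨c - d, sub_ne_zero.2 hne, hsub, by simp [hL]⟩
  have hcd : w c = w d :=
    le_antisymm (hc.2.2 d hd.1 hd.2.1 hL.symm) (hd.2.2 c hc.1 hc.2.1 hL)
  have hsupp : ∀ i, i ∈ support c ∪ support d → i ∈ support (c + d) := by
    intro i hi h0
    have h1 := hc.1 i
    have h2 := hd.1 i
    simp only [Pi.zero_apply, Pi.add_apply] at h0 h1 h2
    have h3 : c i = 0 := by linarith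
    have h4 : d i = 0 := by linarith
    rcases hi with hi | hi
    · exact hi h3
    · exact hi h4
  have key : ∀ r : ι → ℝ, support r ⊆ support c ∪ support d → L r = 0 → 0 ≤ w r := by
    intro r hr hLr
    obtain ⟨t, ht, hnn⟩ := exists_pos_nonneg_add_smul (h := c + d) (r := r)
      (add_nonneg hc.1 hd.1) (fun i hi => hsupp i (hr hi))
    have h1 := hc.2.2 ((2⁻¹ : ℝ) • (c + d + t • r)) (smul_nonneg (by norm_num) hnn)
      (hA.mono hU ?_) ?_
    · simp only [map_add, map_smul, smul_eq_mul] at h1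
      have : 0 ≤ t * w r := by linarith
      exact nonneg_of_mul_nonneg_right this ht
    · intro i hi
      by_contra hcon
      have h0 : r i = 0 := by
        by_contra hne
        exact hcon (hr (mem_support.2 hne))
      simp only [Set.mem_union, mem_support, not_or, not_not] at hcon
      exact hi (by simp [hcon, h0])
    · rw [map_smul, map_add, map_add, map_smul, hLr, ← hL, smul_zero, add_zero, ← two_smul ℝ,
        smul_smul]
      norm_num
  have h1 := key r hr hLr
  have h2 := key (-r) (by simpa using hr) (by simp [hLr])
  rw [map_neg] at h2
  exact hwr (by linarith)

theorem IsMinRep.eq_zero_of_map_eq_zero (hA : IsCompatible L A) (hw : IsGenericWeight L w)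
    (hc : IsMinRep L A w c) {r : ι → ℝ} (hr : support r ⊆ support c) (hLr : L r = 0) :
    r = 0 := by
  obtain ⟨t, ht, hnn⟩ := exists_pos_nonneg_add_smul hc.1 hr
  have hmin : IsMinRep L A w (c + t • r) := by
    refine hc.of_support_subset hA hnn fun i hi => ?_
    by_contra hcon
    have h0 : r i = 0 := by
      by_contra hne
      exact hcon (hr (mem_support.2 hne))
    exact hi (by simp [notMem_support.1 hcon, h0])
  have := hc.unique hA hw hmin (by simp [hLr])
  have h2 : t • r = 0 := by simpa using this
  exact (smul_eq_zero.1 h2).resolve_left ht.ne'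

theorem exists_isMinRep (hA : ∀ ⦃S T⦄, A S → T ⊆ S → A T) (hc : 0 ≤ c) (hAc : A (support c))
    {δ B : ℝ} (hδ : 0 < δ)
    (hw : ∀ d, 0 ≤ d → A (support d) → L d = L c → δ * ∑ i, d i + B ≤ w d) :
    ∃ d, IsMinRep L A w d ∧ L d = L c := by
  have hcont : Continuous w := w.continuous_of_finiteDimensional
  set K : Set (ι → ℝ) := {d | 0 ≤ d ∧ A (support d) ∧ L d = L c ∧ w d ≤ w c} with hK
  have hclosed : IsClosed K := by
    have h1 : IsClosed {d : ι → ℝ | 0 ≤ d} := isClosed_Ici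
    -- As admissibility passes to subsets, the admissible vectors form a finite union of coordinate
    -- subspaces.
    have h2 : IsClosed {d : ι → ℝ | A (support d)} := by
      have : {d : ι → ℝ | A (support d)} =
          ⋃ S ∈ {S : Set ι | A S}, ⋂ i ∈ Sᶜ, {d : ι → ℝ | d i = 0} := by
        ext d
        simp only [Set.mem_ofPred_eq, Set.mem_iUnion, Set.mem_iInter, Set.mem_compl_iff, exists_prop]
        constructor
        · intro h
          exact ⟨_, h, fun i hi => notMem_support.1 hi⟩
        · rintro ⟨S, hS, h⟩
          refine hA hS fun i hi => ?_
          by_contra hcon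
          exact hi (h i hcon)
      rw [this]
      refine Set.Finite.isClosed_biUnion (Set.toFinite _) fun S _ => ?_
      exact isClosed_biInter fun i _ => isClosed_eq (continuous_apply i) continuous_const
    have h3 : IsClosed {d : ι → ℝ | L d = L c} := by
      have h4 : IsClosed (LinearMap.ker L : Set (ι → ℝ)) := Submodule.closed_of_finiteDimensional _
      have : {d : ι → ℝ | L d = L c} = (fun d => d - c) ⁻¹' (LinearMap.ker L : Set (ι → ℝ)) := by
        ext d
        simp [sub_eq_zero]
      rw [this]
      exact h4.preimage (by fun_prop)
    have h4 : IsClosed {d : ι → ℝ | w d ≤ w c} := isClosed_le hcont continuous_const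
    exact h1.inter (h2.inter (h3.inter h4))
  have hbdd : K ⊆ Set.Icc 0 (fun _ => (w c - B) / δ) := by
    rintro d ⟨h0, hAd, hL, hwd⟩
    refine ⟨h0, fun i => ?_⟩
    have h1 := hw d h0 hAd hL
    have h2 : d i ≤ ∑ i, d i := Finset.single_le_sum (fun j _ => h0 j) (Finset.mem_univ i)
    rw [le_div_iff₀ hδ]
    nlinarith
  have hcompact : IsCompact K := isCompact_Icc.of_isClosed_subset hclosed hbdd
  obtain ⟨d, hd, hmin⟩ := hcompact.exists_isMinOn ⟨c, hc, hAc, rfl, le_rfl⟩ hcont.continuousOn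
  refine ⟨d, ⟨hd.1, hd.2.1, fun e he hAe hL => ?_⟩, hd.2.2.1⟩
  by_cases h : w e ≤ w c
  · exact hmin ⟨he, hAe, hL.trans hd.2.2.1, h⟩
  · exact hd.2.2.2.trans (not_le.1 h).le

end MinimalRepresentations

/-! ### Choice of the weight, and its perturbation of a convex functional. -/

section Weights

open Function Filter

variable {ι V : Type*} [Fintype ι] [AddCommGroup V] [Module ℝ V]
variable {L : (ι → ℝ) →ₗ[ℝ] V} {A : Set ι → Prop} {w : (ι → ℝ) →ₗ[ℝ] ℝ} {c d : ι → ℝ}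

theorem eventually_add_mul_ne_zero {a b : ℝ} (ha : a ≠ 0) : ∀ᶠ K : ℝ in atTop, a + K * b ≠ 0 := by
  by_cases hb : b = 0
  · simp [hb, ha]
  · filter_upwards [eventually_ne_atTop (-a / b)] with K hK h
    exact hK (by rw [eq_div_iff hb]; linarith)

/-- There is a generic weight, positive on the orthant, which is minimal on representations
supported in an independent subset of `P`, compared to those supported outside `P`. -/
theorem exists_isGenericWeight (L : (ι → ℝ) →ₗ[ℝ] V) (P : Set ι) :
    ∃ w : (ι → ℝ) →ₗ[ℝ] ℝ, IsGenericWeight L w ∧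
      (∃ δ : ℝ, 0 < δ ∧ ∀ c, 0 ≤ c → δ * ∑ i, c i ≤ w c) ∧
      ∀ S ⊆ P, (∀ r, support r ⊆ S → L r = 0 → r = 0) → ∀ c e, support c ⊆ S → 0 ≤ e →
        (∀ i ∈ P, e i = 0) → L c = L e → w c ≤ w e := by
  classical
  -- One nonzero relation `v T` per dependent set `T` suffices for genericity. There are finitely
  -- many, so `f` can avoid vanishing on all of them, and adding a large multiple of `g`, later of
  -- `q`, does not spoil this.
  let D := {T : Set ι // ∃ r, r ≠ 0 ∧ support r ⊆ T ∧ L r = 0}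
  choose v hv0 hvT hvL using fun T : D => T.2
  obtain ⟨f, hf⟩ := Module.exists_dual_forall_apply_ne_zero (K := ℝ) v hv0
  let g : (ι → ℝ) →ₗ[ℝ] ℝ := ∑ i, LinearMap.proj i
  let q : (ι → ℝ) →ₗ[ℝ] ℝ := ∑ i, (if i ∈ P then (0 : ℝ) else 1) • LinearMap.proj i
  have hg : ∀ c, g c = ∑ i, c i := fun c => by simp [g]
  have hq : ∀ c, q c = ∑ i, (if i ∈ P then (0 : ℝ) else 1) * c i := fun c => by
    simp only [q, LinearMap.sum_apply, LinearMap.smul_apply, LinearMap.proj_apply, smul_eq_mul]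
  obtain ⟨K, hK1, hK2⟩ := ((eventually_all.2 fun T : D =>
    eventually_add_mul_ne_zero (b := g (v T)) (hf T)).and (eventually_all.2 fun i : ι =>
      eventually_ge_atTop (1 - f (Pi.single i 1)))).exists
  set w₁ : (ι → ℝ) →ₗ[ℝ] ℝ := f + K • g with hw₁
  have hsum : ∀ (h : (ι → ℝ) →ₗ[ℝ] ℝ) (c : ι → ℝ), h c = ∑ i, c i * h (Pi.single i 1) := by
    intro h c
    conv_lhs => rw [← Finset.univ_sum_single c, map_sum]
    refine Finset.sum_congr rfl fun i _ => ?_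
    have : Pi.single i (c i) = c i • (Pi.single i 1 : ι → ℝ) := by
      rw [← Pi.single_smul, smul_eq_mul, mul_one]
    rw [this, map_smul, smul_eq_mul]
  have hw₁pos : ∀ i, 1 ≤ w₁ (Pi.single i 1) := by
    intro i
    have := hK2 i
    simp only [hw₁, LinearMap.add_apply, LinearMap.smul_apply, hg, smul_eq_mul,
      Finset.sum_pi_single', Finset.mem_univ, if_true]
    linarith
  -- For independent `S` the weight of a combination supported in `S` is a linear form `m S` of its
  -- value. Taking `M` above every `m S (L (Pi.single i 1))` then bounds this form on `L e` by `M *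
  -- ∑ i, e i`, which `w e` exceeds when `e` vanishes on `P`.
  have hext : ∀ S : Set ι, ∃ m : V →ₗ[ℝ] ℝ, (∀ r, support r ⊆ S → L r = 0 → r = 0) →
      ∀ c, support c ⊆ S → m (L c) = w₁ c := by
    intro S
    by_cases hS : ∀ r, support r ⊆ S → L r = 0 → r = 0
    · let p : Submodule ℝ (ι → ℝ) := Submodule.pi Sᶜ (fun _ => ⊥)
      have hp : ∀ r, r ∈ p ↔ support r ⊆ S := by
        intro r
        simp only [p, Submodule.mem_pi, Set.mem_compl_iff, Submodule.mem_bot]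
        exact ⟨fun h i hi => by_contra fun hn => hi (h i hn),
          fun h i hi => by_contra fun hn => hi (h hn)⟩
      have hker : LinearMap.ker (L.domRestrict p) = ⊥ := by
        rw [LinearMap.ker_eq_bot']
        intro r hr
        exact Subtype.ext (hS r ((hp _).1 r.2) hr)
      obtain ⟨k, hk⟩ := LinearMap.exists_leftInverse_of_injective _ hker
      refine ⟨w₁ ∘ₗ p.subtype ∘ₗ k, fun _ c hc => ?_⟩
      have := LinearMap.congr_fun hk ⟨c, (hp c).2 hc⟩
      simp only [LinearMap.comp_apply, LinearMap.domRestrict_apply, LinearMap.id_apply] at this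
      simp [this]
    · exact ⟨0, fun h => absurd h hS⟩
  choose m hm using hext
  obtain ⟨M, ⟨hM1, hM2⟩, hM0⟩ := (((eventually_all.2 fun T : D =>
    eventually_add_mul_ne_zero (b := q (v T)) (hK1 T)).and (eventually_all.2 fun x : Set ι × ι =>
      eventually_ge_atTop (m x.1 (L (Pi.single x.2 1))))).and (eventually_ge_atTop (0 : ℝ))).exists
  have hw : ∀ c, (w₁ + M • q) c = w₁ c + M * q c := fun c => by simp
  refine ⟨w₁ + M • q, fun T hT => ⟨v ⟨T, hT⟩, hvT _, hvL _, ?_⟩, ⟨1, one_pos, fun c hc => ?_⟩, ?_⟩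
  · rw [hw]
    exact hM1 ⟨T, hT⟩
  · rw [hw, one_mul, hsum w₁]
    have h1 : ∑ i, c i ≤ ∑ i, c i * w₁ (Pi.single i 1) :=
      Finset.sum_le_sum fun i _ => le_mul_of_one_le_right (hc i) (hw₁pos i)
    have h2 : 0 ≤ q c := by
      rw [hq]
      exact Finset.sum_nonneg fun i _ => mul_nonneg (by split_ifs <;> norm_num) (hc i)
    nlinarith
  · intro S hSP hS c e hc he heP hL
    have hqc : q c = 0 := by
      rw [hq]
      refine Finset.sum_eq_zero fun i _ => ?_
      by_cases hi : i ∈ P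
      · simp [hi]
      · have : c i = 0 := by_contra fun hn => hi (hSP (hc hn))
        simp [this]
    have hqe : q e = ∑ i, e i := by
      rw [hq]
      refine Finset.sum_congr rfl fun i _ => ?_
      by_cases hi : i ∈ P
      · simp [heP i hi]
      · simp [hi]
    rw [hw, hw, hqc, hqe, mul_zero, add_zero, ← hm S hS c hc, hL]
    have h1 := hsum (m S ∘ₗ L) e
    rw [LinearMap.comp_apply] at h1
    rw [h1, hsum w₁, Finset.mul_sum, ← Finset.sum_add_distrib]
    refine Finset.sum_le_sum fun i _ => ?_
    have h2 : m S (L (Pi.single i 1)) ≤ M := hM2 (S, i)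
    have h3 := hw₁pos i
    have h4 : 0 ≤ e i := he i
    rw [LinearMap.comp_apply]
    nlinarith

/-- Compatibility does most of the work: two representations of one vector that together would cover
`P` make `P` admissible. This forces `P \ {i}` to be independent and every competitor to vanish at
`i`. Cancelling the part of the competitor inside `P` leaves a comparison with a vector supported
off `P`, where the weight is large. -/
theorem isMinRep_of_ssubset_primitive {P : Set ι} (hA : IsCompatible L A)
    (hP : ¬ A P) (hPA : ∀ i ∈ P, A (P \ {i}))
    (hw : ∀ S ⊆ P, (∀ r, support r ⊆ S → L r = 0 → r = 0) → ∀ c e, support c ⊆ S → 0 ≤ e →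
        (∀ i ∈ P, e i = 0) → L c = L e → w c ≤ w e)
    {i : ι} (hi : i ∈ P) (hc : 0 ≤ c) (hcP : support c ⊆ P \ {i}) : IsMinRep L A w c := by
  classical
  have hzero : ∀ a b : ι → ℝ, 0 ≤ a → 0 ≤ b → L a = L b → support a ⊆ P \ {i} →
      support b ⊆ P \ {i} → (∀ j, a j = 0 ∨ b j = 0) → b = 0 := by
    intro a b ha hb hL haP hbP hab
    by_contra hne
    obtain ⟨j, hj⟩ := Function.ne_iff.1 hne
    have hjP := (hbP hj).1
    refine hP (hA.mono (hA.union (S := P \ {j}) ha hb hL ?_ (hPA j hjP)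
      (hA.mono (hPA i hi) hbP)) ?_)
    · intro k hk
      refine ⟨(haP hk).1, fun hkj => ?_⟩
      rw [Set.mem_singleton_iff] at hkj
      subst hkj
      exact (hab k).elim hk hj
    · intro k hk
      by_cases hkj : k = j
      · exact Or.inr (hkj ▸ hj)
      · exact Or.inl ⟨hk, hkj⟩
  have hinj : ∀ r, support r ⊆ P \ {i} → L r = 0 → r = 0 := by
    intro r hr hLr
    have hp : support r⁺ ⊆ P \ {i} := fun j hj => hr fun h0 => hj (by simp [h0])
    have hn : support r⁻ ⊆ P \ {i} := fun j hj => hr fun h0 => hj (by simp [h0])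
    have hL : L r⁺ = L r⁻ := by
      rw [← sub_eq_zero, ← map_sub, posPart_sub_negPart, hLr]
    have hdisj : ∀ j, r⁺ j = 0 ∨ r⁻ j = 0 := by
      intro j
      rcases le_total (r j) 0 with h | h
      · exact Or.inl (by simpa using h)
      · exact Or.inr (by simpa using h)
    have h1 := hzero _ _ (posPart_nonneg r) (negPart_nonneg r) hL hp hn hdisj
    have h2 := hzero _ _ (negPart_nonneg r) (posPart_nonneg r) hL.symm hn hp
      fun j => (hdisj j).symm
    rw [← posPart_sub_negPart r, h1, h2, sub_zero]
  refine ⟨hc, hA.mono (hPA i hi) hcP, fun d hd hAd hL => ?_⟩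
  have hU := hA.union hc hd hL.symm hcP (hPA i hi) hAd
  have hdi : d i = 0 := by
    by_contra hne
    refine hP (hA.mono hU fun k hk => ?_)
    by_cases hki : k = i
    · exact Or.inr (hki ▸ hne)
    · exact Or.inl ⟨hk, hki⟩
  set d₁ : ι → ℝ := P.indicator d with hd₁
  -- `c - d₁` may have negative entries, which `hw` allows for its first vector.
  have h := hw (P \ {i}) Set.sdiff_subset hinj (c - d₁) (d - d₁) ?_ ?_ ?_ ?_
  · simpa using h
  · intro k hk
    by_contra hcon
    have hck : c k = 0 := by_contra fun hn => hcon (hcP hn)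
    by_cases hkP : k ∈ P
    · have : k = i := by_contra fun hn => hcon ⟨hkP, hn⟩
      subst this
      exact hk (by simp [hck, hd₁, hkP, hdi])
    · exact hk (by simp [hck, hd₁, hkP])
  · intro k
    by_cases hkP : k ∈ P
    · simp [hd₁, hkP]
    · simpa [hd₁, hkP] using hd k
  · intro k hk
    simp [hd₁, hk]
  · simp [hL]

/-- Perturbing a functional `Φ` which detects admissibility by a small multiple of a weight turns
admissible minimality into global minimality. -/
theorem exists_pos_isMinRep_iff {Φ : (ι → ℝ) →ₗ[ℝ] ℝ}
    (hΦ : ∀ c, 0 ≤ c → ∃ d, 0 ≤ d ∧ A (support d) ∧ L d = L c ∧ Φ d ≤ Φ c ∧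
      (¬ A (support c) → Φ d < Φ c))
    (hΦA : ∀ c d, 0 ≤ c → 0 ≤ d → A (support c) → A (support d) → L c = L d → Φ c = Φ d)
    (hw : ∃ δ : ℝ, 0 < δ ∧ ∀ c, 0 ≤ c → δ * ∑ i, c i ≤ w c) :
    ∃ ε : ℝ, 0 < ε ∧ ∀ c, IsMinRep L A w c ↔ IsMinRep L (fun _ => True) (Φ + ε • w) c := by
  classical
  let ind : Set ι → ι → ℝ := fun T => T.indicator 1
  have hind : ∀ T, 0 ≤ ind T := fun T => Set.indicator_nonneg fun _ _ => zero_le_one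
  have hinds : ∀ T, support (ind T) = T := fun T => by
    ext i
    by_cases hi : i ∈ T <;> simp [ind, hi]
  choose d hd hdA hdL hdΦ hdlt using fun T => hΦ (ind T) (hind T)
  -- Only the finitely many inadmissible supports matter: for each, trading the indicator for `d T`
  -- strictly lowers `Φ`, and for large `K` this gain outweighs any change in `K⁻¹ * w`.
  obtain ⟨K, hK, hK0⟩ := ((eventually_all.2 fun T : {T : Set ι // ¬ A T} =>
    ((eventually_gt_atTop ((w (d T) - w (ind T)) / (Φ (ind T) - Φ (d T)))))).and
      (eventually_gt_atTop (0 : ℝ))).exists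
  have hlt : ∀ T, ¬ A T → Φ (d T) + K⁻¹ * w (d T) < Φ (ind T) + K⁻¹ * w (ind T) := by
    intro T hT
    have h1 := hdlt T (by rwa [hinds])
    have h2 : (w (d T) - w (ind T)) / (Φ (ind T) - Φ (d T)) < K := hK ⟨T, hT⟩
    rw [div_lt_iff₀ (sub_pos.2 h1)] at h2
    have h3 := mul_lt_mul_of_pos_left h2 (inv_pos.2 hK0)
    rw [← mul_assoc, inv_mul_cancel₀ hK0.ne', one_mul] at h3
    linarith
  refine ⟨K⁻¹, inv_pos.2 hK0, ?_⟩
  set ε := K⁻¹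
  have hε : 0 < ε := inv_pos.2 hK0
  have hadm : ∀ c, IsMinRep L (fun _ => True) (Φ + ε • w) c → A (support c) := by
    intro c hc
    by_contra hcon
    obtain ⟨t, ht, hnn⟩ := exists_pos_nonneg_add_smul (h := c) (r := - ind (support c)) hc.1
      (by rw [support_neg, hinds])
    have h1 := hc.2.2 (c + t • (- ind (support c)) + t • d (support c))
      (add_nonneg hnn (smul_nonneg ht.le (hd _))) trivial (by simp [hdL])
    have h2 := hlt _ hcon
    simp only [map_add, map_smul, map_neg, LinearMap.add_apply, LinearMap.smul_apply,
      smul_eq_mul] at h1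
    nlinarith
  have hmin : ∀ c, IsMinRep L (fun _ => True) (Φ + ε • w) c → IsMinRep L A w c := by
    intro c hc
    refine ⟨hc.1, hadm c hc, fun e he hAe hL => ?_⟩
    have h1 := hc.2.2 e he trivial hL
    have h2 := hΦA e c he hc.1 hAe (hadm c hc) hL
    simp only [LinearMap.add_apply, LinearMap.smul_apply, smul_eq_mul, h2] at h1
    exact le_of_mul_le_mul_left (by linarith) hε
  intro c
  refine ⟨fun hc => ?_, hmin c⟩
  obtain ⟨δ, hδ, hwδ⟩ := hw
  -- A global minimizer exists because `Φ c`, with `c` admissible, is the least value of `Φ` on the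
  -- fibre. Being admissible, the minimizer has the same `Φ` as `c`, so `c` ties with it.
  obtain ⟨e, he, heL⟩ := exists_isMinRep (L := L) (A := fun _ => True) (w := Φ + ε • w) (c := c)
    (δ := ε * δ) (B := Φ c) (fun _ _ _ _ => trivial) hc.1 trivial (by positivity) (by
      intro x hx _ hxL
      obtain ⟨y, hy, hyA, hyL, hyΦ, -⟩ := hΦ x hx
      have h1 := hΦA y c hy hc.1 hyA hc.2.1 (hyL.trans hxL)
      have h2 := mul_le_mul_of_nonneg_left (hwδ x hx) hε.le
      simp only [LinearMap.add_apply, LinearMap.smul_apply, smul_eq_mul]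
      linarith)
  refine ⟨hc.1, trivial, fun x hx _ hxL => ?_⟩
  have h1 := he.2.2 x hx trivial (hxL.trans heL.symm)
  have h2 := hc.2.2 e he.1 (hadm e he) heL
  have h3 := hΦA e c he.1 hc.1 (hadm e he) hc.2.1 heL
  have h4 := mul_le_mul_of_nonneg_left h2 hε.le
  simp only [LinearMap.add_apply, LinearMap.smul_apply, smul_eq_mul] at h1 ⊢
  linarith

end Weights

/-! ### Finitely generated cones and their extremal generators. -/

section Hull

open Function

variable {ι V : Type*} [Fintype ι] [AddCommGroup V] [Module ℝ V]

theorem PointedCone.mem_hull_image_iff {u : ι → V} {S : Set ι} {x : V} :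
    x ∈ PointedCone.hull ℝ (u '' S) ↔
      ∃ c : ι → ℝ, 0 ≤ c ∧ support c ⊆ S ∧ Fintype.linearCombination ℝ u c = x := by
  classical
  constructor
  · intro hx
    induction hx using Submodule.span_induction with
    | mem x hx =>
      obtain ⟨i, hi, rfl⟩ := hx
      refine ⟨Pi.single i 1, by simp, ?_, by simp⟩
      exact Pi.support_single_subset.trans (by simpa using hi)
    | zero => exact ⟨0, le_rfl, by simp, by simp⟩
    | add x y _ _ hx hy =>
      obtain ⟨c, hc, hcS, rfl⟩ := hx
      obtain ⟨d, hd, hdS, rfl⟩ := hy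
      exact ⟨c + d, add_nonneg hc hd, (support_add c d).trans (Set.union_subset hcS hdS), by simp⟩
    | smul a x _ hx =>
      obtain ⟨c, hc, hcS, rfl⟩ := hx
      refine ⟨(a : ℝ) • c, smul_nonneg a.2 hc, (support_const_smul_subset _ _).trans hcS, ?_⟩
      rw [map_smul]
      rfl
  · rintro ⟨c, hc, hcS, rfl⟩
    rw [Fintype.linearCombination_apply]
    refine Submodule.sum_mem _ fun i _ => ?_
    by_cases hi : c i = 0
    · simp [hi]
    · exact PointedCone.smul_mem _ (hc i) (PointedCone.subset_hull ⟨i, hcS hi, rfl⟩)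

theorem PointedCone.mem_hull_singleton_iff {v x : V} :
    x ∈ PointedCone.hull ℝ {v} ↔ ∃ a : ℝ, 0 ≤ a ∧ a • v = x := by
  rw [Submodule.mem_span_singleton]
  exact ⟨fun ⟨a, ha⟩ => ⟨a, a.2, ha⟩, fun ⟨a, ha, h⟩ => ⟨⟨a, ha⟩, h⟩⟩

/-- A finitely generated salient cone is generated by those of its generators which span
extremal rays. -/
theorem PointedCone.exists_subset_hull_eq_of_salient {σ : PointedCone ℝ V} {s : Set V}
    (hs : s.Finite) (hσ : σ = PointedCone.hull ℝ s) (hsal : σ.toConvexCone.Salient) :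
    ∃ t ⊆ s, PointedCone.hull ℝ t = σ ∧
      ∀ v ∈ t, v ≠ 0 ∧ (PointedCone.hull ℝ {v}).IsFaceOf σ := by
  have hfin : {t : Set V | t ⊆ s ∧ PointedCone.hull ℝ t = σ}.Finite :=
    hs.finite_subsets.subset fun t ht => ht.1
  obtain ⟨t, ⟨hts, htσ⟩, hmin⟩ := hfin.exists_minimal ⟨s, subset_rfl, hσ.symm⟩
  refine ⟨t, hts, htσ, fun v hv => ?_⟩
  have hvn : v ∉ PointedCone.hull ℝ (t \ {v}) := by
    intro hcon
    have : PointedCone.hull ℝ (t \ {v}) = σ := by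
      rw [← htσ]
      refine le_antisymm (Submodule.span_mono Set.sdiff_subset) (Submodule.span_le.2 fun w hw => ?_)
      by_cases hwv : w = v
      · exact hwv ▸ hcon
      · exact PointedCone.subset_hull ⟨hw, hwv⟩
    exact (hmin ⟨Set.sdiff_subset.trans hts, this⟩ Set.sdiff_subset hv).2 rfl
  have hle : PointedCone.hull ℝ (t \ {v}) ≤ σ := htσ ▸ Submodule.span_mono Set.sdiff_subset
  have hvσ : v ∈ σ := htσ ▸ PointedCone.subset_hull hv
  have hdec : ∀ x ∈ σ, ∃ a : ℝ, 0 ≤ a ∧ ∃ y ∈ PointedCone.hull ℝ (t \ {v}), x = a • v + y := by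
    intro x hx
    rw [← htσ, ← Set.insert_sdiff_self_of_mem hv, Submodule.mem_span_insert] at hx
    obtain ⟨a, y, hy, rfl⟩ := hx
    exact ⟨a, a.2, y, hy, rfl⟩
  refine ⟨fun h0 => hvn (h0 ▸ Submodule.zero_mem _), ?_⟩
  refine PointedCone.IsFaceOf.of_mem_of_add_mem_left
    (Submodule.span_le.2 (Set.singleton_subset_iff.2 hvσ)) fun {x y} hx hy hxy => ?_
  obtain ⟨a, ha, x', hx', rfl⟩ := hdec x hx
  obtain ⟨b, hb, y', hy', rfl⟩ := hdec y hy
  obtain ⟨e, he, hxy⟩ := PointedCone.mem_hull_singleton_iff.1 hxy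
  -- A positive coefficient would put `v` in the hull of the other generators, against minimality of
  -- `t`; otherwise `-x'` lies in `σ`, and salience gives `x' = 0`.
  have hsum : x' + y' = (e - a - b) • v := by
    rw [sub_smul, sub_smul, hxy]
    abel
  have hneg : e - a - b ≤ 0 := by
    by_contra hpos
    push Not at hpos
    have : (e - a - b)⁻¹ • (x' + y') = v := by
      rw [hsum, smul_smul, inv_mul_cancel₀ hpos.ne', one_smul]
    have hmem := PointedCone.smul_mem _ (inv_pos.2 hpos).le (add_mem hx' hy')
    rw [this] at hmem
    exact hvn hmem
  have hx0 : x' = 0 := by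
    by_contra hne
    refine hsal x' (hle hx') hne ?_
    have : -x' = y' + (a + b - e) • v := by
      have h1 : (a + b - e) • v = -(x' + y') := by
        rw [hsum, ← neg_smul]
        congr 1
        ring
      rw [h1]
      abel
    rw [this]
    exact add_mem (hle hy') (PointedCone.smul_mem _ (by linarith) hvσ)
  rw [hx0, add_zero]
  exact PointedCone.mem_hull_singleton_iff.2 ⟨a, ha, rfl⟩

end Hull

/-! ### Ray generators and convex functions on a fan. -/

namespace ToricFan

variable {N : Type*} [AddCommGroup N] {F : ToricFan N}

/-- A choice of lattice generators of the rays of a fan. -/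
structure IsRayGenerators (F : ToricFan N) (u : F.rays → RealSpan N) : Prop where
  lattice : ∀ ρ, ∃ v : N, (1 : ℝ) ⊗ₜ[ℤ] v = u ρ
  ne_zero : ∀ ρ, u ρ ≠ 0
  hull_eq : ∀ ρ, ρ.1 = PointedCone.hull ℝ {u ρ}

theorem finrank_span_hull_singleton {v : RealSpan N} (hv : v ≠ 0) :
    Module.finrank ℝ (Submodule.span ℝ
      (PointedCone.hull ℝ {v} : Set (RealSpan N))) = 1 := by
  have : Submodule.span ℝ (PointedCone.hull ℝ {v} : Set (RealSpan N)) = Submodule.span ℝ {v} :=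
    le_antisymm (Submodule.span_le.2 (PointedCone.hull_le_span ℝ {v}))
      (Submodule.span_mono PointedCone.subset_hull)
  rw [this, finrank_span_singleton hv]

theorem exists_ray_generator {ρ : PointedCone ℝ (RealSpan N)} (hρ : ρ ∈ F.rays) :
    ∃ v : N, (1 : ℝ) ⊗ₜ[ℤ] v ≠ 0 ∧ ρ = PointedCone.hull ℝ {(1 : ℝ) ⊗ₜ[ℤ] v} := by
  obtain ⟨hρF, hdim⟩ := hρ
  obtain ⟨s, hs⟩ := F.rational ρ hρF
  have hsal := F.stronglyConvex ρ hρF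
  obtain ⟨v, hvs, hv⟩ : ∃ v ∈ s, (1 : ℝ) ⊗ₜ[ℤ] v ≠ 0 := by
    by_contra hcon
    push Not at hcon
    have h0 : ρ = ⊥ := by
      rw [hs, Submodule.span_eq_bot]
      rintro _ ⟨v, hv, rfl⟩
      exact hcon v hv
    rw [h0, Submodule.bot_coe, Submodule.span_zero_singleton, finrank_bot] at hdim
    exact zero_ne_one hdim
  have hvρ : (1 : ℝ) ⊗ₜ[ℤ] v ∈ ρ := by
    rw [hs]
    exact PointedCone.subset_hull ⟨v, hvs, rfl⟩
  refine ⟨v, hv, le_antisymm (fun x hx => ?_)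
    (Submodule.span_le.2 (Set.singleton_subset_iff.2 hvρ))⟩
  have hne : (⟨_, Submodule.subset_span hvρ⟩ :
      Submodule.span ℝ (ρ : Set (RealSpan N))) ≠ 0 := fun h => hv (congrArg Subtype.val h)
  obtain ⟨a, ha⟩ := (finrank_eq_one_iff_of_nonzero' _ hne).1 hdim ⟨x, Submodule.subset_span hx⟩
  have ha' : a • ((1 : ℝ) ⊗ₜ[ℤ] v : RealSpan N) = x := congrArg Subtype.val ha
  refine PointedCone.mem_hull_singleton_iff.2 ⟨a, ?_, ha'⟩
  by_contra hneg
  push Not at hneg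
  refine hsal _ hvρ hv ?_
  have : -((1 : ℝ) ⊗ₜ[ℤ] v : RealSpan N) = (-a)⁻¹ • x := by
    rw [← ha', smul_smul, inv_neg, neg_mul, inv_mul_cancel₀ hneg.ne, neg_smul, one_smul]
  rw [this]
  exact PointedCone.smul_mem _ (inv_nonneg.2 (by linarith)) hx

theorem exists_isRayGenerators (F : ToricFan N) : ∃ u, F.IsRayGenerators u := by
  choose v hv0 hv using fun ρ : F.rays => exists_ray_generator ρ.2
  exact ⟨fun ρ => (1 : ℝ) ⊗ₜ[ℤ] v ρ, fun ρ => ⟨v ρ, rfl⟩, hv0, hv⟩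

theorem mem_of_sum_smul_mem {ι V : Type*} [Fintype ι] [AddCommGroup V] [Module ℝ V]
    {σ τ : PointedCone ℝ V} (h : σ.IsFaceOf τ) {u : ι → V} {c : ι → ℝ} (hc : 0 ≤ c)
    (hcτ : ∀ i, c i ≠ 0 → u i ∈ τ) (hmem : Fintype.linearCombination ℝ u c ∈ σ) {i : ι}
    (hi : c i ≠ 0) : u i ∈ σ := by
  rw [Fintype.linearCombination_apply] at hmem
  have h1 := h.mem_of_sum_mem (f := fun i => c i • u i) (fun i => ?_) hmem i
  · have := PointedCone.smul_mem σ (inv_nonneg.2 (hc i)) h1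
    rwa [smul_smul, inv_mul_cancel₀ hi, one_smul] at this
  · by_cases h0 : c i = 0
    · simp [h0]
    · exact PointedCone.smul_mem _ (hc i) (hcτ i h0)

theorem add_mem_support (hconv : Convex ℝ F.support) {x y : RealSpan N} (hx : x ∈ F.support)
    (hy : y ∈ F.support) : x + y ∈ F.support := by
  obtain ⟨σ, hσ, h⟩ := hconv hx hy (a := 2⁻¹) (b := 2⁻¹) (by norm_num) (by norm_num) (by norm_num)
  refine ⟨σ, hσ, ?_⟩
  have := PointedCone.smul_mem σ (zero_le_two (α := ℝ)) h
  rwa [← smul_add, smul_smul, mul_inv_cancel₀ two_ne_zero, one_smul] at this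

/-- Jensen's inequality with its equality case. Under equality, the new term and the partial sum
share a cone `σ`, while by induction the earlier terms share a cone `τ`. The partial sum lies in the
face `σ ⊓ τ` of `τ`, so all the earlier terms do too. -/
theorem sum_le_of_isStrictlyConvex {φ : RealSpan N → ℝ} (hconv : Convex ℝ F.support)
    (hφ : F.IsPiecewiseLinear φ) (hφs : F.IsStrictlyConvex φ) {ι : Type*} (s : Finset ι)
    (x : ι → RealSpan N) (hx : ∀ i ∈ s, x i ∈ F.support) :
    ∑ i ∈ s, x i ∈ F.support ∧ φ (∑ i ∈ s, x i) ≤ ∑ i ∈ s, φ (x i) ∧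
      (φ (∑ i ∈ s, x i) = ∑ i ∈ s, φ (x i) → ∃ σ ∈ F.cones, ∀ i ∈ s, x i ∈ σ) := by
  classical
  induction s using Finset.induction_on with
  | empty =>
    obtain ⟨σ, hσ⟩ := F.nonempty
    obtain ⟨m, hm⟩ := hφ σ hσ
    refine ⟨⟨σ, hσ, by simp⟩, ?_, fun _ => ⟨σ, hσ, by simp⟩⟩
    simp [hm 0 σ.zero_mem]
  | insert a s ha ih =>
    obtain ⟨h1, h2, h3⟩ := ih fun i hi => hx i (Finset.mem_insert_of_mem hi)
    have hxa := hx a (Finset.mem_insert_self a s)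
    rw [Finset.sum_insert ha, Finset.sum_insert ha]
    refine ⟨add_mem_support hconv hxa h1, ?_⟩
    by_cases hcone : ∃ σ ∈ F.cones, x a ∈ σ ∧ ∑ i ∈ s, x i ∈ σ
    · obtain ⟨σ, hσ, haσ, hsσ⟩ := hcone
      obtain ⟨m, hm⟩ := hφ σ hσ
      have hadd : φ (x a + ∑ i ∈ s, x i) = φ (x a) + φ (∑ i ∈ s, x i) := by
        rw [hm _ (add_mem haσ hsσ), hm _ haσ, hm _ hsσ, map_add]
      refine ⟨by linarith, fun heq => ?_⟩
      obtain ⟨τ, hτ, hsτ⟩ := h3 (by linarith)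
      refine ⟨σ, hσ, fun i hi => ?_⟩
      rcases Finset.mem_insert.1 hi with rfl | hi
      · exact haσ
      · have hf := (F.inter_face σ hσ τ hτ).2
        have hmem : ∑ i ∈ s, x i ∈ σ ⊓ τ := ⟨hsσ, sum_mem hsτ⟩
        rw [← Finset.sum_coe_sort] at hmem
        exact (hf.mem_of_sum_mem (fun i : s => hsτ i i.2) hmem ⟨i, hi⟩).1
    · have := hφs _ hxa _ h1 fun ⟨σ, hσ, h⟩ => hcone ⟨σ, hσ, h⟩
      exact ⟨by linarith, fun heq => by linarith⟩

/-- The rays of `S` lie in a single cone of `F`. -/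
def RaysInCone (F : ToricFan N) (S : Set F.rays) : Prop := ∃ σ ∈ F.cones, ∀ ρ ∈ S, ρ.1 ≤ σ

namespace IsRayGenerators

variable {u : F.rays → RealSpan N}

theorem le_iff (hu : F.IsRayGenerators u) {ρ : F.rays} {σ : PointedCone ℝ (RealSpan N)} :
    ρ.1 ≤ σ ↔ u ρ ∈ σ := by
  rw [hu.hull_eq, Submodule.span_le, Set.singleton_subset_iff, SetLike.mem_coe]

theorem eq_of_le (hu : F.IsRayGenerators u) {ρ ρ' : F.rays} (h : ρ.1 ≤ ρ'.1) : ρ = ρ' := by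
  have h1 := hu.le_iff.1 h
  rw [hu.hull_eq ρ', PointedCone.mem_hull_singleton_iff] at h1
  obtain ⟨a, ha, h1⟩ := h1
  have ha0 : a ≠ 0 := by
    rintro rfl
    exact hu.ne_zero ρ (by rw [← h1, zero_smul])
  refine Subtype.ext (le_antisymm h (hu.le_iff.2 ?_))
  have : u ρ' = a⁻¹ • u ρ := by rw [← h1, smul_smul, inv_mul_cancel₀ ha0, one_smul]
  rw [this]
  exact PointedCone.smul_mem _ (inv_nonneg.2 ha) (hu.le_iff.1 le_rfl)

variable [Fintype F.rays]

theorem linearCombination_mem (hu : F.IsRayGenerators u)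
    {σ : PointedCone ℝ (RealSpan N)} {c : F.rays → ℝ} (hc : 0 ≤ c)
    (hcσ : ∀ ρ ∈ Function.support c, ρ.1 ≤ σ) : Fintype.linearCombination ℝ u c ∈ σ := by
  have : PointedCone.hull ℝ (u '' Function.support c) ≤ σ := by
    rw [Submodule.span_le]
    rintro _ ⟨ρ, hρ, rfl⟩
    exact hu.le_iff.1 (hcσ ρ hρ)
  exact this (PointedCone.mem_hull_image_iff.2 ⟨c, hc, subset_rfl, rfl⟩)

theorem le_of_linearCombination_mem (hu : F.IsRayGenerators u)
    {σ : PointedCone ℝ (RealSpan N)} (hσ : σ ∈ F.cones)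
    {c : F.rays → ℝ} (hc : 0 ≤ c) (hcA : F.RaysInCone (Function.support c))
    (hmem : Fintype.linearCombination ℝ u c ∈ σ) {ρ : F.rays} (hρ : ρ ∈ Function.support c) :
    ρ.1 ≤ σ := by
  obtain ⟨τ, hτ, hcτ⟩ := hcA
  have h1 := mem_of_sum_smul_mem (F.inter_face σ hσ τ hτ).2 hc
    (fun i hi => hu.le_iff.1 (hcτ i hi)) ⟨hmem, hu.linearCombination_mem hc hcτ⟩ hρ
  exact hu.le_iff.2 h1.1

/-- This is where the intersection axiom of a fan enters: an admissible combination with value in a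
cone `σ` has its value in a common face with `σ`, hence all its rays in `σ`. -/
theorem isCompatible (hu : F.IsRayGenerators u) :
    IsCompatible (Fintype.linearCombination ℝ u) F.RaysInCone where
  mono _ _ := fun ⟨σ, hσ, h⟩ hTS => ⟨σ, hσ, fun ρ hρ => h ρ (hTS hρ)⟩
  union _ _ _ := fun hc hd hL hcS ⟨σ, hσ, h⟩ hdA => ⟨σ, hσ, fun ρ hρ => hρ.elim (h ρ) fun hρ =>
    hu.le_of_linearCombination_mem hσ hd hdA
      (hL ▸ hu.linearCombination_mem hc fun ρ hρ => h ρ (hcS hρ)) hρ⟩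

/-- Extremal generators of a cone of the fan span one-dimensional faces, and these are rays of the
fan. -/
theorem exists_linearCombination_eq (hu : F.IsRayGenerators u)
    {σ : PointedCone ℝ (RealSpan N)} (hσ : σ ∈ F.cones)
    {x : RealSpan N} (hx : x ∈ σ) : ∃ c : F.rays → ℝ, 0 ≤ c ∧ (∀ ρ ∈ Function.support c, ρ.1 ≤ σ) ∧
      Fintype.linearCombination ℝ u c = x := by
  obtain ⟨s, hs⟩ := F.rational σ hσ
  obtain ⟨t, -, htσ, ht⟩ := PointedCone.exists_subset_hull_eq_of_salient
    (s.finite_toSet.image _) hs (F.stronglyConvex σ hσ)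
  have hle : σ ≤ PointedCone.hull ℝ (u '' {ρ | ρ.1 ≤ σ}) := by
    rw [← htσ, Submodule.span_le]
    intro v hv
    obtain ⟨hv0, hvf⟩ := ht v hv
    let ρ : F.rays := ⟨PointedCone.hull ℝ {v}, F.face_mem σ hσ _ hvf,
      finrank_span_hull_singleton hv0⟩
    have h1 : v ∈ PointedCone.hull ℝ {u ρ} := by
      rw [← hu.hull_eq ρ]
      exact PointedCone.subset_hull rfl
    refine Submodule.span_mono (Set.singleton_subset_iff.2 ?_) h1
    refine ⟨ρ, ?_, rfl⟩
    exact htσ ▸ hvf.le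
  obtain ⟨c, hc, hcS, hL⟩ := PointedCone.mem_hull_image_iff.1 (hle hx)
  exact ⟨c, hc, fun ρ hρ => hcS hρ, hL⟩

end IsRayGenerators

end ToricFan

/-! ### The fan of minimal combinations and its properties. -/

namespace ToricFan

variable {N : Type*} [AddCommGroup N] {F F' : ToricFan N} {u : F.rays → RealSpan N}
  [Fintype F.rays] {w : (F.rays → ℝ) →ₗ[ℝ] ℝ} {c d : F.rays → ℝ}

/-- A nonnegative combination of rays in a cone of `F`, of minimal weight among those with the same
value. -/
abbrev IsMinComb (F : ToricFan N) [Fintype F.rays] (u : F.rays → RealSpan N)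
    (w : (F.rays → ℝ) →ₗ[ℝ] ℝ) (c : F.rays → ℝ) : Prop :=
  IsMinRep (Fintype.linearCombination ℝ u) F.RaysInCone w c

/-- The cone generated by the rays occurring in a combination. -/
abbrev supportCone (u : F.rays → RealSpan N) (c : F.rays → ℝ) : PointedCone ℝ (RealSpan N) :=
  PointedCone.hull ℝ (u '' Function.support c)

/-- A weight which is bounded below by a positive multiple of the sum of the coordinates. -/
def IsCoercive (w : (F.rays → ℝ) →ₗ[ℝ] ℝ) : Prop :=
  ∃ δ : ℝ, 0 < δ ∧ ∀ c, 0 ≤ c → δ * ∑ ρ, c ρ ≤ w c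

theorem IsMinComb.indicator (hu : F.IsRayGenerators u) (hc : F.IsMinComb u w c) (S : Set F.rays) :
    F.IsMinComb u w (S.indicator c) := by
  refine IsMinRep.of_support_subset hu.isCompatible hc
    (Set.indicator_nonneg fun ρ _ => hc.1 ρ) ?_
  rw [Set.support_indicator]
  exact Set.inter_subset_right

theorem exists_isMinComb (hu : F.IsRayGenerators u) (hw : IsCoercive w) {x : RealSpan N}
    (hx : x ∈ F.support) : ∃ c, F.IsMinComb u w c ∧ Fintype.linearCombination ℝ u c = x := by
  obtain ⟨σ, hσ, hxσ⟩ := hx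
  obtain ⟨c, hc, hcσ, rfl⟩ := hu.exists_linearCombination_eq hσ hxσ
  obtain ⟨δ, hδ, hwδ⟩ := hw
  exact exists_isMinRep (B := 0) hu.isCompatible.mono hc ⟨σ, hσ, hcσ⟩ hδ
    fun d hd _ _ => by simpa using hwδ d hd

theorem IsMinComb.supportCone_le (hu : F.IsRayGenerators u) (hc : F.IsMinComb u w c) :
    ∃ σ ∈ F.cones, supportCone u c ≤ σ := by
  obtain ⟨σ, hσ, h⟩ := hc.2.1
  refine ⟨σ, hσ, Submodule.span_le.2 ?_⟩
  rintro _ ⟨ρ, hρ, rfl⟩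
  exact hu.le_iff.1 (h ρ hρ)

theorem IsMinComb.mem_support (hu : F.IsRayGenerators u) (hc : F.IsMinComb u w c) :
    Fintype.linearCombination ℝ u c ∈ F.support := by
  obtain ⟨σ, hσ, h⟩ := hc.2.1
  exact ⟨σ, hσ, hu.linearCombination_mem hc.1 h⟩

/-- A point `x + y` of both cones has a representation from each side, and both are minimal, hence
equal. So the rays used by `x` already occur in `d`. -/
theorem IsMinComb.inter_isFaceOf (hu : F.IsRayGenerators u)
    (hw : IsGenericWeight (Fintype.linearCombination ℝ u) w) (hc : F.IsMinComb u w c)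
    (hd : F.IsMinComb u w d) : (supportCone u c ⊓ supportCone u d).IsFaceOf (supportCone u c) := by
  refine PointedCone.IsFaceOf.of_mem_of_add_mem_left inf_le_left fun {x y} hx hy hxy => ⟨hx, ?_⟩
  obtain ⟨a, ha, hac, rfl⟩ := PointedCone.mem_hull_image_iff.1 hx
  obtain ⟨b, hb, hbc, rfl⟩ := PointedCone.mem_hull_image_iff.1 hy
  obtain ⟨e, he, hed, hL⟩ := PointedCone.mem_hull_image_iff.1 hxy.2
  have h1 : F.IsMinComb u w (a + b) := IsMinRep.of_support_subset hu.isCompatible hc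
    (add_nonneg ha hb) ((Function.support_add a b).trans (Set.union_subset hac hbc))
  have h2 : F.IsMinComb u w e := IsMinRep.of_support_subset hu.isCompatible hd he hed
  have h3 : a + b = e := IsMinRep.unique hu.isCompatible hw h1 h2 (by rw [hL, map_add])
  refine PointedCone.mem_hull_image_iff.2 ⟨a, ha, fun ρ hρ => hed ?_, rfl⟩
  rw [← h3]
  have h4 : 0 < a ρ := lt_of_le_of_ne (ha ρ) (Ne.symm hρ)
  exact (add_pos_of_pos_of_nonneg h4 (hb ρ)).ne'

theorem eq_supportCone_of_isFaceOf {τ : PointedCone ℝ (RealSpan N)}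
    (hτ : τ.IsFaceOf (supportCone u c)) : τ = supportCone u ({ρ | u ρ ∈ τ}.indicator c) := by
  refine le_antisymm (fun x hx => ?_) (Submodule.span_le.2 ?_)
  · obtain ⟨a, ha, hac, rfl⟩ := PointedCone.mem_hull_image_iff.1 (hτ.le hx)
    refine PointedCone.mem_hull_image_iff.2 ⟨a, ha, fun ρ hρ => ?_, rfl⟩
    rw [Set.support_indicator]
    exact ⟨mem_of_sum_smul_mem hτ ha
      (fun i hi => PointedCone.subset_hull ⟨i, hac hi, rfl⟩) hx hρ, hac hρ⟩
  · rintro _ ⟨ρ, hρ, rfl⟩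
    rw [Set.support_indicator] at hρ
    exact hρ.1

/-- The regular subdivision of a fan defined by a generic weight on its rays. -/
theorem exists_toricFan_cones_eq (hu : F.IsRayGenerators u)
    (hw : IsGenericWeight (Fintype.linearCombination ℝ u) w) (hpos : IsCoercive w) :
    ∃ F' : ToricFan N, F'.cones = {σ | ∃ c, F.IsMinComb u w c ∧ σ = supportCone u c} := by
  refine ⟨⟨{σ | ∃ c, F.IsMinComb u w c ∧ σ = supportCone u c}, ?_, ?_, ?_, ?_, ?_, ?_⟩, rfl⟩
  · refine (Set.finite_range fun S : Set F.rays => PointedCone.hull ℝ (u '' S)).subset ?_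
    rintro _ ⟨c, -, rfl⟩
    exact ⟨_, rfl⟩
  · obtain ⟨σ, hσ⟩ := F.nonempty
    obtain ⟨c, hc, -⟩ := exists_isMinComb hu hpos ⟨σ, hσ, σ.zero_mem⟩
    exact ⟨_, c, hc, rfl⟩
  · rintro _ ⟨c, -, rfl⟩
    choose v hv using hu.lattice
    classical
    refine ⟨(Set.toFinite (Function.support c)).toFinset.image v, ?_⟩
    rw [Finset.coe_image, Set.Finite.coe_toFinset, Set.image_image]
    simp only [hv]
  · rintro _ ⟨c, hc, rfl⟩ x hx hx0 hnx
    obtain ⟨σ, hσ, hle⟩ := hc.supportCone_le hu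
    exact F.stronglyConvex σ hσ x (hle hx) hx0 (hle hnx)
  · rintro _ ⟨c, hc, rfl⟩ τ hτ
    exact ⟨_, hc.indicator hu _, eq_supportCone_of_isFaceOf hτ⟩
  · rintro _ ⟨c, hc, rfl⟩ _ ⟨d, hd, rfl⟩
    exact ⟨hc.inter_isFaceOf hu hw hd, inf_comm (supportCone u c) _ ▸ hd.inter_isFaceOf hu hw hc⟩

theorem IsMinComb.linearIndepOn (hu : F.IsRayGenerators u)
    (hw : IsGenericWeight (Fintype.linearCombination ℝ u) w) (hc : F.IsMinComb u w c) :
    LinearIndepOn ℝ u (Function.support c) := by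
  rw [linearIndepOn_iff]
  intro l hl hl0
  rw [Finsupp.linearCombination_apply, Finsupp.sum_fintype _ _ (by simp)] at hl0
  have h1 : (l : F.rays → ℝ) = 0 := IsMinRep.eq_zero_of_map_eq_zero hu.isCompatible hw hc
    (fun ρ hρ => hl (Finsupp.mem_support_iff.2 hρ)) hl0
  exact DFunLike.coe_injective h1

theorem simplicial_of_cones_eq (hu : F.IsRayGenerators u)
    (hw : IsGenericWeight (Fintype.linearCombination ℝ u) w)
    (hF' : F'.cones = {σ | ∃ c, F.IsMinComb u w c ∧ σ = supportCone u c}) : F'.Simplicial := by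
  intro σ hσ
  rw [hF'] at hσ
  obtain ⟨c, hc, rfl⟩ := hσ
  exact PointedCone.IsSimplicial.hull (Set.toFinite _) (hc.linearIndepOn hu hw).id_image

theorem refines_of_cones_eq (hu : F.IsRayGenerators u) (hpos : IsCoercive w)
    (hF' : F'.cones = {σ | ∃ c, F.IsMinComb u w c ∧ σ = supportCone u c}) : F'.Refines F := by
  have hle : ∀ σ' ∈ F'.cones, ∃ σ ∈ F.cones, σ' ≤ σ := by
    intro σ hσ
    rw [hF'] at hσ
    obtain ⟨c, hc, rfl⟩ := hσ
    exact hc.supportCone_le hu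
  refine ⟨Set.Subset.antisymm ?_ fun x hx => ?_, hle⟩
  · rintro x ⟨σ', hσ', hx⟩
    obtain ⟨σ, hσ, h⟩ := hle σ' hσ'
    exact ⟨σ, hσ, h hx⟩
  · obtain ⟨c, hc, rfl⟩ := exists_isMinComb hu hpos hx
    refine ⟨supportCone u c, hF' ▸ ⟨c, hc, rfl⟩, ?_⟩
    exact PointedCone.mem_hull_image_iff.2 ⟨c, hc.1, subset_rfl, rfl⟩

/-- Any admissible representation of `u ρ` uses only rays contained in the cone `ρ`, that is, `ρ`
alone; there is no competitor, whatever the weight. -/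
theorem isMinComb_single [DecidableEq F.rays] (hu : F.IsRayGenerators u) (ρ : F.rays) :
    F.IsMinComb u w (Pi.single ρ 1) := by
  have hLρ : Fintype.linearCombination ℝ u (Pi.single ρ 1) = u ρ := by simp
  refine ⟨by simp, ⟨ρ, ρ.2.1, fun i hi => ?_⟩, fun d hd hdA hL => ?_⟩
  · have := Pi.support_single_subset hi
    rw [Set.mem_singleton_iff] at this
    rw [this]
  · have hdρ : ∀ i, i ≠ ρ → d i = 0 := by
      intro i hi
      by_contra hne
      refine hi (hu.eq_of_le (hu.le_of_linearCombination_mem ρ.2.1 hd hdA ?_ hne))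
      rw [hL, hLρ]
      exact hu.le_iff.1 le_rfl
    have h1 : d = Pi.single ρ (d ρ) := by
      ext i
      by_cases hi : i = ρ
      · subst hi
        simp
      · simp [hi, hdρ i hi]
    have h2 : d ρ = 1 := by
      rw [h1, hLρ, Fintype.linearCombination_apply_single] at hL
      have : (d ρ - 1) • u ρ = 0 := by rw [sub_smul, hL, one_smul, sub_self]
      linarith [(smul_eq_zero.1 this).resolve_right (hu.ne_zero ρ)]
    rw [h1, h2]

theorem rays_eq_of_cones_eq (hu : F.IsRayGenerators u)
    (hw : IsGenericWeight (Fintype.linearCombination ℝ u) w)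
    (hF' : F'.cones = {σ | ∃ c, F.IsMinComb u w c ∧ σ = supportCone u c}) :
    F'.rays = F.rays := by
  classical
  ext σ
  constructor
  · rintro ⟨hσ, hdim⟩
    rw [hF'] at hσ
    obtain ⟨c, hc, rfl⟩ := hσ
    have hli := hc.linearIndepOn hu hw
    have hspan : Submodule.span ℝ (supportCone u c : Set (RealSpan N)) =
        Submodule.span ℝ (u '' Function.support c) :=
      le_antisymm (Submodule.span_le.2 (PointedCone.hull_le_span ℝ _))
        (Submodule.span_mono PointedCone.subset_hull)
    rw [hspan] at hdim
    have hcard : Fintype.card (Function.support c) = 1 := by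
      rw [← hdim, Set.image_eq_range]
      exact (finrank_span_eq_card hli).symm
    obtain ⟨⟨ρ, hρ⟩, huniq⟩ := Fintype.card_eq_one_iff.1 hcard
    have hs : Function.support c = {ρ} :=
      Set.eq_singleton_iff_unique_mem.2 ⟨hρ, fun i hi => congrArg Subtype.val (huniq ⟨i, hi⟩)⟩
    rw [supportCone, hs, Set.image_singleton, ← hu.hull_eq]
    exact ρ.2
  · intro hσ
    refine ⟨?_, hσ.2⟩
    rw [hF']
    refine ⟨_, isMinComb_single hu ⟨σ, hσ⟩, ?_⟩
    have hs : Function.support (Pi.single ⟨σ, hσ⟩ 1 : F.rays → ℝ) = {⟨σ, hσ⟩} := by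
      rw [Pi.support_single_of_ne one_ne_zero]
    rw [supportCone, hs, Set.image_singleton, ← hu.hull_eq]

theorem isPrimitiveCollection_of_cones_eq {P : Set (PointedCone ℝ (RealSpan N))}
    (hP : F.IsPrimitiveCollection P) (hu : F.IsRayGenerators u)
    (hw : ∀ S ⊆ {ρ : F.rays | ρ.1 ∈ P},
      (∀ r, Function.support r ⊆ S → Fintype.linearCombination ℝ u r = 0 → r = 0) →
      ∀ c e, Function.support c ⊆ S → 0 ≤ e → (∀ ρ ∈ {ρ : F.rays | ρ.1 ∈ P}, e ρ = 0) →
        Fintype.linearCombination ℝ u c = Fintype.linearCombination ℝ u e → w c ≤ w e)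
    (hF' : F'.cones = {σ | ∃ c, F.IsMinComb u w c ∧ σ = supportCone u c})
    (hrays : F'.rays = F.rays) (href : F'.Refines F) : F'.IsPrimitiveCollection P := by
  obtain ⟨hPr, hPn, hPs⟩ := hP
  refine ⟨hrays ▸ hPr, fun ⟨σ', hσ', h⟩ => ?_, fun Q hQ => ?_⟩
  · obtain ⟨σ, hσ, hle⟩ := href.2 σ' hσ'
    exact hPn ⟨σ, hσ, fun ρ hρ => (h ρ hρ).trans hle⟩
  · obtain ⟨ρ, hρP, hρQ⟩ := Set.exists_of_ssubset hQ
    -- A proper subset misses some `ρ`, so it is enough that the rays of `P` other than `ρ` span a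
    -- cone of `F'`.
    set S : Set F.rays := {ρ : F.rays | ρ.1 ∈ P} \ {⟨ρ, hPr hρP⟩} with hS
    have hSs : Function.support (S.indicator (1 : F.rays → ℝ)) = S := by
      ext i
      by_cases hi : i ∈ S <;> simp [hi]
    have hmin : F.IsMinComb u w (S.indicator 1) := by
      refine isMinRep_of_ssubset_primitive (P := {ρ : F.rays | ρ.1 ∈ P}) hu.isCompatible ?_ ?_ hw
        (i := ⟨ρ, hPr hρP⟩) hρP (Set.indicator_nonneg fun _ _ => zero_le_one) hSs.le
      · rintro ⟨σ, hσ, h⟩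
        exact hPn ⟨σ, hσ, fun ρ hρ => h ⟨ρ, hPr hρ⟩ hρ⟩
      · intro i hi
        obtain ⟨σ, hσ, h⟩ := hPs (P \ {i.1}) ⟨Set.sdiff_subset, fun h => (h hi).2 rfl⟩
        exact ⟨σ, hσ, fun ρ hρ => h ρ ⟨hρ.1, fun hn => hρ.2 (Subtype.ext hn)⟩⟩
    refine ⟨_, hF'.symm.subset ⟨_, hmin, rfl⟩, fun τ hτ => ?_⟩
    have hτP := hQ.1 hτ
    refine (hu.le_iff (ρ := ⟨τ, hPr hτP⟩)).2 (PointedCone.subset_hull ⟨_, ?_, rfl⟩)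
    rw [hSs]
    refine ⟨hτP, fun hn => hρQ ?_⟩
    have : τ = ρ := congrArg Subtype.val hn
    exact this ▸ hτ

/-- Removes the admissibility constraint: `Φ` agrees with `φ` of the value on admissible
combinations and, by the equality case of Jensen, is strictly larger on the others. -/
theorem exists_pos_isMinComb_iff {φ : RealSpan N → ℝ} (hu : F.IsRayGenerators u)
    (hpos : IsCoercive w) (hconv : Convex ℝ F.support)
    (hφ : F.IsPiecewiseLinear φ) (hφs : F.IsStrictlyConvex φ) :
    ∃ W : (F.rays → ℝ) →ₗ[ℝ] ℝ, ∀ c, F.IsMinComb u w c ↔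
      IsMinRep (Fintype.linearCombination ℝ u) (fun _ => True) W c := by
  set Φ : (F.rays → ℝ) →ₗ[ℝ] ℝ := Fintype.linearCombination ℝ fun ρ => φ (u ρ) with hΦ
  have hΦA : ∀ c : F.rays → ℝ, 0 ≤ c → F.RaysInCone (Function.support c) →
      Φ c = φ (Fintype.linearCombination ℝ u c) := by
    rintro c hc ⟨σ, hσ, hcσ⟩
    obtain ⟨m, hm⟩ := hφ σ hσ
    rw [hm _ (hu.linearCombination_mem hc hcσ), hΦ, Fintype.linearCombination_apply,
      Fintype.linearCombination_apply, map_sum]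
    refine Finset.sum_congr rfl fun ρ _ => ?_
    by_cases h0 : c ρ = 0
    · simp [h0]
    · rw [map_smul, hm _ (hu.le_iff.1 (hcσ ρ h0))]
  suffices h : ∃ ε : ℝ, 0 < ε ∧ ∀ c, F.IsMinComb u w c ↔
      IsMinRep (Fintype.linearCombination ℝ u) (fun _ => True) (Φ + ε • w) c by
    obtain ⟨ε, -, h⟩ := h
    exact ⟨_, h⟩
  refine exists_pos_isMinRep_iff (fun c hc => ?_) (fun c d hc hd hcA hdA hL => ?_) hpos
  · have hmem : ∀ ρ, c ρ • u ρ ∈ ρ.1 := fun ρ =>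
      PointedCone.smul_mem _ (hc ρ) (hu.le_iff.1 le_rfl)
    have hval : ∀ ρ, φ (c ρ • u ρ) = c ρ • φ (u ρ) := by
      intro ρ
      obtain ⟨m, hm⟩ := hφ ρ.1 ρ.2.1
      rw [hm _ (hmem ρ), hm _ (hu.le_iff.1 le_rfl), map_smul]
    obtain ⟨h1, h2, h3⟩ := sum_le_of_isStrictlyConvex hconv hφ hφs Finset.univ
      (fun ρ => c ρ • u ρ) fun ρ _ => ⟨ρ.1, ρ.2.1, hmem ρ⟩
    simp only [hval, ← Fintype.linearCombination_apply] at h1 h2 h3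
    obtain ⟨σ, hσ, hLσ⟩ := h1
    obtain ⟨d, hd, hdσ, hLd⟩ := hu.exists_linearCombination_eq hσ hLσ
    have hΦd := hΦA d hd ⟨σ, hσ, hdσ⟩
    rw [hLd] at hΦd
    refine ⟨d, hd, ⟨σ, hσ, hdσ⟩, hLd, hΦd ▸ h2, fun hcA => lt_of_le_of_ne (hΦd ▸ h2) ?_⟩
    rw [hΦd]
    intro heq
    obtain ⟨τ, hτ, hcτ⟩ := h3 heq
    refine hcA ⟨τ, hτ, fun ρ hρ => hu.le_iff.2 ?_⟩
    have := PointedCone.smul_mem τ (inv_nonneg.2 (hc ρ)) (hcτ ρ (Finset.mem_univ ρ))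
    rwa [smul_smul, inv_mul_cancel₀ hρ, one_smul] at this
  · rw [hΦA c hc hcA, hΦA d hd hdA, hL]

/-- The convex function is `W (r x)`, with `r x` the minimal representation of `x`; on each new cone
`r` inverts the linear combination map, hence linearity. The sum `r x + r y` need not be admissible,
so comparing it with `r (x + y)` needs the unconstrained minimality of `W`. -/
theorem quasiProjective_of_cones_eq (hu : F.IsRayGenerators u)
    (hw : IsGenericWeight (Fintype.linearCombination ℝ u) w) (hpos : IsCoercive w)
    (hF' : F'.cones = {σ | ∃ c, F.IsMinComb u w c ∧ σ = supportCone u c})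
    (href : F'.Refines F) (hconv : Convex ℝ F.support) (hq : F.QuasiProjective) :
    F'.QuasiProjective := by
  classical
  obtain ⟨φ, hφ, hφs⟩ := hq
  obtain ⟨W, hW⟩ := exists_pos_isMinComb_iff hu hpos hconv hφ hφs
  have hrep : ∀ x : RealSpan N, ∃ c, x ∈ F.support →
      F.IsMinComb u w c ∧ Fintype.linearCombination ℝ u c = x := by
    intro x
    by_cases hx : x ∈ F.support
    · obtain ⟨c, hc⟩ := exists_isMinComb hu hpos hx
      exact ⟨c, fun _ => hc⟩
    · exact ⟨0, fun h => absurd h hx⟩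
  choose r hr using hrep
  have hrL : ∀ c, F.IsMinComb u w c → r (Fintype.linearCombination ℝ u c) = c := by
    intro c hc
    obtain ⟨h1, h2⟩ := hr _ (hc.mem_support hu)
    exact IsMinRep.unique hu.isCompatible hw h1 hc h2
  refine ⟨fun x => W (r x), fun σ hσ => ?_, fun x hx y hy hxy => ?_⟩
  · rw [hF'] at hσ
    obtain ⟨c, hc, rfl⟩ := hσ
    have hli := hc.linearIndepOn hu hw
    obtain ⟨m, hm⟩ : ∃ m : Module.Dual ℝ (RealSpan N),
        ∀ ρ ∈ Function.support c, m (u ρ) = W (Pi.single ρ 1) := by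
      let b := Module.Basis.extend hli.id_image
      refine ⟨b.constr ℝ fun v => Function.extend (fun ρ : Function.support c => u ρ)
        (fun ρ => W (Pi.single ρ.1 1)) 0 v.1, fun ρ hρ => ?_⟩
      have hmem : u ρ ∈ hli.id_image.extend (Set.subset_univ _) :=
        hli.id_image.subset_extend _ ⟨ρ, hρ, rfl⟩
      have hb : b ⟨u ρ, hmem⟩ = u ρ := Module.Basis.extend_apply_self _ _
      conv_lhs => rw [← hb]
      rw [Module.Basis.constr_basis]
      exact (LinearIndependent.injective hli).extend_apply _ _ ⟨ρ, hρ⟩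
    refine ⟨m, fun x hx => ?_⟩
    obtain ⟨a, ha, hac, rfl⟩ := PointedCone.mem_hull_image_iff.1 hx
    have hamin : F.IsMinComb u w a := IsMinRep.of_support_subset hu.isCompatible hc ha hac
    simp only [hrL a hamin]
    conv_lhs => rw [← Finset.univ_sum_single a, map_sum]
    rw [Fintype.linearCombination_apply, map_sum]
    refine Finset.sum_congr rfl fun ρ _ => ?_
    by_cases h0 : a ρ = 0
    · simp [h0]
    · have : Pi.single ρ (a ρ) = a ρ • (Pi.single ρ 1 : F.rays → ℝ) := by
        rw [← Pi.single_smul, smul_eq_mul, mul_one]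
      rw [this, map_smul, map_smul, hm ρ (hac h0)]
  · rw [href.1] at hx hy
    obtain ⟨hcx, hLx⟩ := hr x hx
    obtain ⟨hcy, hLy⟩ := hr y hy
    obtain ⟨hcz, hLz⟩ := hr _ (add_mem_support hconv hx hy)
    have hnn : 0 ≤ r x + r y := add_nonneg hcx.1 hcy.1
    have hLxy : Fintype.linearCombination ℝ u (r x + r y) = x + y := by rw [map_add, hLx, hLy]
    have hWz := ((hW _).1 hcz).2.2
    rw [← map_add]
    refine lt_of_le_of_ne (hWz _ hnn trivial (hLxy.trans hLz.symm)) fun heq => hxy ?_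
    -- Equality would make `r x + r y` itself minimal, and the cone on its support contains both `x`
    -- and `y`.
    have hmin : F.IsMinComb u w (r x + r y) := (hW _).2 ⟨hnn, trivial, fun d hd _ hL =>
      heq ▸ hWz d hd trivial (hL.trans (hLxy.trans hLz.symm))⟩
    refine ⟨_, hF'.symm.subset ⟨_, hmin, rfl⟩, ?_, ?_⟩
    · refine PointedCone.mem_hull_image_iff.2 ⟨r x, hcx.1, fun ρ hρ => ?_, hLx⟩
      have h4 : 0 < r x ρ := lt_of_le_of_ne (hcx.1 ρ) (Ne.symm hρ)
      exact (add_pos_of_pos_of_nonneg h4 (hcy.1 ρ)).ne'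
    · refine PointedCone.mem_hull_image_iff.2 ⟨r y, hcy.1, fun ρ hρ => ?_, hLy⟩
      have h4 : 0 < r y ρ := lt_of_le_of_ne (hcy.1 ρ) (Ne.symm hρ)
      exact (add_pos_of_nonneg_of_pos (hcx.1 ρ) h4).ne'

end ToricFan

theorem mainTheorem4 {N : Type*} [AddCommGroup N] [Module.Free ℤ N] [Module.Finite ℤ N]
    (F : ToricFan N) (hF : F.HasConvexFullSupport)
    (P : Set (PointedCone ℝ (RealSpan N))) (hP : F.IsPrimitiveCollection P) :
    (∃ F' : ToricFan N, F'.Simplicial ∧ F'.Refines F ∧ F'.rays = F.rays ∧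
      F'.IsPrimitiveCollection P) ∧
    (F.QuasiProjective →
      ∃ F' : ToricFan N, F'.Simplicial ∧ F'.Refines F ∧ F'.rays = F.rays ∧
        F'.IsPrimitiveCollection P ∧ F'.QuasiProjective) := by
  have : Finite F.rays := (F.finite.subset fun _ h => h.1).to_subtype
  have := Fintype.ofFinite F.rays
  obtain ⟨u, hu⟩ := F.exists_isRayGenerators
  obtain ⟨w, hw, hpos, hwP⟩ :=
    exists_isGenericWeight (Fintype.linearCombination ℝ u) {ρ : F.rays | ρ.1 ∈ P}
  obtain ⟨F', hF'⟩ := ToricFan.exists_toricFan_cones_eq hu hw hpos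
  have hsimp := ToricFan.simplicial_of_cones_eq hu hw hF'
  have href := ToricFan.refines_of_cones_eq hu hpos hF'
  have hrays := ToricFan.rays_eq_of_cones_eq hu hw hF'
  have hprim := ToricFan.isPrimitiveCollection_of_cones_eq hP hu hwP hF' hrays href
  exact ⟨⟨F', hsimp, href, hrays, hprim⟩, fun hq => ⟨F', hsimp, href, hrays, hprim,
    ToricFan.quasiProjective_of_cones_eq hu hw hpos hF' href hF.1 hq⟩⟩
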